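/- **Setting.** Let $X\subset\mathbb R^n$ be compact, $\mu$ a Borel probability measure with $\mu(\mathbb R^n\setminus X)=0$, $y_1,\dots,y_N\in\mathbb R^n$, and let $c(\cdot,y_i)$ be continuous on $X$ for each $i$; put $\|c\|_\infty=\sup_{x\in X,\,i}|c(x,y_i)|$. For $\psi\in\mathbb R^N$ let $\mathrm{Lag}_i(\psi)=\{x\in X: c(x,y_i)+\psi^i=\min_k (c(x,y_k)+\psi^k)\}$ and $\mathcal K^0=\{\psi\in\mathbb R^N:\mu(\mathrm{Lag}_i(\psi))>0\text{ for all }i\}$. Let $\Lambda=\{w\in\mathbb R^N:\sum_i w^i=1,\ w^i\ge 0\}$. Let $F:\mathbb R^N\to\mathbb R\cup\{+\infty\}$ be a proper closed convex function which is $+\infty$ outside $\Lambda$, and suppose that $F$ splits: $F(w)=\sum_i f_i(w^i)+\delta_\Lambda(w)$, where $\delta_\Lambda$ is $0$ on $\Lambda$ and $+\infty$ off $\Lambda$, and each $f_i:\mathbb R\to\mathbb R\cup\{+\infty\}$ is proper, closed and convex with $\mathrm{dom} f_i\subset[0,1]$. Let $F^*(\psi)=\sup_w(\langle w,\psi\rangle-F(w))$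 be the conjugate of $F$. Assume that each $f_i$ is essentially smooth (the interior $C_i$ of $\mathrm{dom} f_i$ is nonempty, $f_i$ is differentiable on $C_i$, and $|f_i'(x_m)|\to\infty$ whenever $x_m\in C_i$ converges to a boundary point of $C_i$), that $f_i$ is twice differentiable on $C_i$ with $f_i''$ locally Lipschitz on $C_i$, and that $f_i''\ge\eta$ on $C_i$ for some $\eta>0$ independent of $i$. **Constants.** Let $a_i=\inf\mathrm{dom} f_i$, $b_i=\sup\mathrm{dom} f_i$, $A=\frac{1-\sum_i a_i}{N}$, $B=\frac{\sum_i b_i-1}{N}$, $$C_1=\max\Big\{0,\ \max_{k:\,a_k+A\in C_k}\big(-f_k'(a_k+A)\big),\ \max_{k:\,b_k-B\in C_k}f_k'(b_k-B)\Big\}+2\|c\|_\infty ,$$ (maxima over an empty set of indices are omitted), and $$S_i=\{x\in C_i:|f_i'(x)|\le C_1\},\qquad C_f=\max_i\ \sup_{x,z\in S_i,\ x\ne z}\frac{|f_i''(x)-f_i''(z)|}{|x-z|}$$ (a supremum over the empty set being $0$). **Theorem.** 1. $F^*$ is finite everywhere, is $C^2$ on $\mathbb R^N$, and is $C^{2,1}$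 on $\mathcal K^0$, i.e. its second derivative is Lipschitz on $\mathcal K^0$. 2. Suppose that $\mathrm{dom} F$ is not a single point. Then for every $\psi\in\mathbb R^N$, with $w=\nabla F^*(\psi)$, one has $w^i\in C_i$ for all $i$, the bordered matrix $$J=\begin{bmatrix} f_1''(w^1)& & &1\\ &\ddots& &\vdots\\ & &f_N''(w^N)&1\\ 1&\cdots&1&0\end{bmatrix}$$ (the Jacobian in $(w,r)$ of $(w,r)\mapsto(f_1'(w^1)+r-\psi^1,\dots,f_N'(w^N)+r-\psi^N,\sum_i w^i-1)$) is invertible, and $D^2F^*(\psi)$ is $J^{-1}$ with its last row and last column removed. 3. Each $S_i$ is a compact subset of $C_i$, $C_f<\infty$, and for all $\psi_1,\psi_2\in\mathcal K^0$ $$\|D^2F^*(\psi_1)-D^2F^*(\psi_2)\|\le 4N^2\,C_f\,\eta^{-3}\,\|\psi_1-\psi_2\|,$$ where the norm on matrices is the Euclidean (Frobenius) norm. -/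

import Mathlib

noncomputable section

namespace SemiDiscrete

/-! ### Extended-real-valued convex functions -/

/-- Effective domain. -/
def effDom {E : Type*} (f : E → EReal) : Set E := {x | f x < ⊤}

/-- Proper: never `-∞` and not identically `+∞`. -/
def IsProper {E : Type*} (f : E → EReal) : Prop :=
  (∀ x, f x ≠ ⊥) ∧ (effDom f).Nonempty

/-- Convexity of an extended-real-valued function: its epigraph is convex. -/
def IsConvexFn {E : Type*} [AddCommGroup E] [Module ℝ E] (f : E → EReal) : Prop :=
  Convex ℝ {p : E × ℝ | f p.1 ≤ (p.2 : EReal)}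

/-- Proper closed (lower semicontinuous) convex function. -/
structure IsProperClosedConvex {E : Type*} [AddCommGroup E] [Module ℝ E] [TopologicalSpace E]
    (f : E → EReal) : Prop where
  proper : IsProper f
  closed : LowerSemicontinuous f
  convex : IsConvexFn f

open Classical in
/-- Convex-analytic indicator: `0` on `A` and `+∞` off `A`. -/
def indicatorFn {E : Type*} (A : Set E) (x : E) : EReal := if x ∈ A then 0 else ⊤

/-- Legendre–Fenchel conjugate `F*(ψ) = sup_w (⟨w, ψ⟩ - F(w))`. -/
def conjugate {N : ℕ} (F : EuclideanSpace ℝ (Fin N) → EReal)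
    (ψ : EuclideanSpace ℝ (Fin N)) : EReal :=
  ⨆ w : EuclideanSpace ℝ (Fin N), (((inner ℝ w ψ : ℝ) : EReal) - F w)

/-- The conjugate as a real-valued function (meaningful where the conjugate is finite). -/
def conjugateReal {N : ℕ} (F : EuclideanSpace ℝ (Fin N) → EReal)
    (ψ : EuclideanSpace ℝ (Fin N)) : ℝ := (conjugate F ψ).toReal

/-! ### Functions of one variable -/

/-- Interior of the effective domain. -/
def intDom (f : ℝ → EReal) : Set ℝ := interior (effDom f)

/-- First derivative of an extended-real-valued function; used on `intDom f` only. -/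
def d1 (f : ℝ → EReal) : ℝ → ℝ := deriv (fun x => (f x).toReal)

/-- Second derivative of an extended-real-valued function; used on `intDom f` only. -/
def d2 (f : ℝ → EReal) : ℝ → ℝ := deriv (d1 f)

/-- Essentially smooth: the interior `C` of the domain is nonempty, `f` is differentiable on `C`,
and `|f'(x_n)| → ∞` along every sequence of `C` that converges to a boundary point of `C`. -/
def IsEssentiallySmooth (f : ℝ → EReal) : Prop :=
  (intDom f).Nonempty ∧
  DifferentiableOn ℝ (fun x => (f x).toReal) (intDom f) ∧
  ∀ (x : ℕ → ℝ) (b : ℝ), (∀ m, x m ∈ intDom f) → b ∈ frontier (intDom f) →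
    Filter.Tendsto x Filter.atTop (nhds b) →
    Filter.Tendsto (fun m => |d1 f (x m)|) Filter.atTop Filter.atTop

/-! ### Storage fee functions -/

/-- The set of admissible weight vectors (the unit simplex). -/
def weightSet (N : ℕ) : Set (EuclideanSpace ℝ (Fin N)) :=
  {w | ∑ i, w i = 1 ∧ ∀ i, 0 ≤ w i}

/-- Storage fee function: proper closed convex, and `+∞` off the simplex. -/
def IsStorageFee {N : ℕ} (F : EuclideanSpace ℝ (Fin N) → EReal) : Prop :=
  IsProperClosedConvex F ∧ ∀ w, w ∉ weightSet N → F w = ⊤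

/-- `F` splits into the functions `f i`. -/
def SplitsInto {N : ℕ} (F : EuclideanSpace ℝ (Fin N) → EReal) (f : Fin N → ℝ → EReal) : Prop :=
  (∀ i, IsProperClosedConvex (f i) ∧ effDom (f i) ⊆ Set.Icc 0 1) ∧
  ∀ w, F w = ∑ i, f i (w i) + indicatorFn (weightSet N) w

/-! ### Laguerre cells -/

/-- The `i`-th Laguerre cell of `ψ`. -/
def laguerreCell {n N : ℕ} (X : Set (EuclideanSpace ℝ (Fin n)))
    (c : EuclideanSpace ℝ (Fin n) → EuclideanSpace ℝ (Fin n) → ℝ)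
    (y : Fin N → EuclideanSpace ℝ (Fin n)) (ψ : EuclideanSpace ℝ (Fin N)) (i : Fin N) :
    Set (EuclideanSpace ℝ (Fin n)) :=
  {x ∈ X | ∀ k, c x (y i) + ψ i ≤ c x (y k) + ψ k}

/-- `K^ε`: the set of `ψ` all of whose Laguerre cells have mass larger than `ε`. -/
def massSet {n N : ℕ} (X : Set (EuclideanSpace ℝ (Fin n)))
    (μ : MeasureTheory.Measure (EuclideanSpace ℝ (Fin n)))
    (c : EuclideanSpace ℝ (Fin n) → EuclideanSpace ℝ (Fin n) → ℝ)
    (y : Fin N → EuclideanSpace ℝ (Fin n)) (ε : ℝ) : Set (EuclideanSpace ℝ (Fin N)) :=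
  {ψ | ∀ i, ε < μ.real (laguerreCell X c y ψ i)}

/-- `‖c‖_∞`, the supremum of `|c(x, y_i)|` over `x ∈ X` and all `i`. -/
def costSup {n N : ℕ} (X : Set (EuclideanSpace ℝ (Fin n)))
    (c : EuclideanSpace ℝ (Fin n) → EuclideanSpace ℝ (Fin n) → ℝ)
    (y : Fin N → EuclideanSpace ℝ (Fin n)) : ℝ :=
  ⨆ p : X × Fin N, |c p.1 (y p.2)|

/-! ### The constants in the Lipschitz estimate -/

/-- Left end point of the domain. -/
def leftEnd (f : ℝ → EReal) : ℝ := sInf (effDom f)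

/-- Right end point of the domain. -/
def rightEnd (f : ℝ → EReal) : ℝ := sSup (effDom f)

/-- `A = (1 - ∑ a_i) / N`. -/
def marginA {N : ℕ} (f : Fin N → ℝ → EReal) : ℝ := (1 - ∑ i, leftEnd (f i)) / N

/-- `B = (∑ b_i - 1) / N`. -/
def marginB {N : ℕ} (f : Fin N → ℝ → EReal) : ℝ := (∑ i, rightEnd (f i) - 1) / N

open Classical in
/-- `C₁ = max (0, max_k (-f_k'(a_k + A)), max_k f_k'(b_k - B)) + 2 ‖c‖_∞`, where an index `k` only
contributes to a maximum if the point in question lies in the interior of the domain of `f_k`.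
The parameter `M` stands for `‖c‖_∞`. -/
def slopeBound {N : ℕ} (f : Fin N → ℝ → EReal) (M : ℝ) : ℝ :=
  max 0 (max
    (⨆ k, if leftEnd (f k) + marginA f ∈ intDom (f k)
      then -d1 (f k) (leftEnd (f k) + marginA f) else 0)
    (⨆ k, if rightEnd (f k) - marginB f ∈ intDom (f k)
      then d1 (f k) (rightEnd (f k) - marginB f) else 0)) + 2 * M

/-- `S_i`: the points of the interior of the domain of `f_i` at which `|f_i'| ≤ C₁`. -/
def slopeSet {N : ℕ} (f : Fin N → ℝ → EReal) (M : ℝ) (i : Fin N) : Set ℝ :=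
  {x ∈ intDom (f i) | |d1 (f i) x| ≤ slopeBound f M}

/-- Difference quotients of `f_i''` on `S_i` (the quotient is `0` for `x = y`). -/
def quotientSet {N : ℕ} (f : Fin N → ℝ → EReal) (M : ℝ) (i : Fin N) : Set ℝ :=
  {q | ∃ x ∈ slopeSet f M i, ∃ z ∈ slopeSet f M i, q = |d2 (f i) x - d2 (f i) z| / |x - z|}

/-- `C_f`, the maximum over `i` of the Lipschitz constant of `f_i''` on `S_i`. -/
def lipConst {N : ℕ} (f : Fin N → ℝ → EReal) (M : ℝ) : ℝ := ⨆ i, sSup (quotientSet f M i)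

/-! ### Second derivatives -/

/-- Hessian matrix. -/
def hessian {N : ℕ} (g : EuclideanSpace ℝ (Fin N) → ℝ) (ψ : EuclideanSpace ℝ (Fin N)) :
    Matrix (Fin N) (Fin N) ℝ :=
  Matrix.of fun i j =>
    fderiv ℝ (fderiv ℝ g) ψ (EuclideanSpace.single i 1) (EuclideanSpace.single j 1)

/-- Euclidean (Frobenius) norm of a matrix. -/
def frobNorm {N : ℕ} (A : Matrix (Fin N) (Fin N) ℝ) : ℝ := Real.sqrt (∑ i, ∑ j, A i j ^ 2)

/-- `g` is `C^{2,1}` on `U`: twice continuously differentiable at the points of `U`, with second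
derivative Lipschitz on `U`. -/
def IsC21On {N : ℕ} (g : EuclideanSpace ℝ (Fin N) → ℝ) (U : Set (EuclideanSpace ℝ (Fin N))) :
    Prop :=
  (∀ ψ ∈ U, ContDiffAt ℝ 2 g ψ) ∧ ∃ K : NNReal, LipschitzOnWith K (fderiv ℝ (fderiv ℝ g)) U

/-- The bordered matrix with diagonal block `diag (f_i''(w^i))`, last row and last column equal to
ones, and corner entry `0`. It is the Jacobian in `(w, r)` of the map
`(w, r) ↦ (f_1'(w^1) + r - ψ^1, …, f_N'(w^N) + r - ψ^N, ∑ w^i - 1)`. -/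
def borderedJacobian {N : ℕ} (f : Fin N → ℝ → EReal) (w : EuclideanSpace ℝ (Fin N)) :
    Matrix (Fin N ⊕ Unit) (Fin N ⊕ Unit) ℝ :=
  Matrix.fromBlocks (Matrix.diagonal fun i => d2 (f i) (w i)) (Matrix.of fun _ _ => 1)
    (Matrix.of fun _ _ => 1) 0

end SemiDiscrete

end

open SemiDiscrete

namespace SemiDiscrete

open Set Filter Topology

/-! Maximizing ⟨w, ψ⟩ - ∑ f_i(w^i) over the simplex is a Lagrange problem: the maximizer should
solve f_i'(w^i) = ψ^i - r with ∑ w^i = 1. Since f_i'' ≥ η and |f_i'| blows up at the ends, f_i' is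
an increasing bijection from C_i onto ℝ, and its inverse `slopeInv` is η⁻¹-Lipschitz. If dom F has
two points, then ∑ a_i < 1 < ∑ b_i, so the simplex meets the product of the C_i, and the
intermediate value theorem produces r. The bound w^i ≥ 0 needs no multiplier, because dom f_i lies
in [0,1]. Tangent lines show that this w is optimal (`inner_sub_le`), and w(ψ) is the gradient of
F*.

Differentiating the system gives Dw = `condensedInv d` with d_i = f_i''(w^i): the matrix D⁻¹ minus a
rank-one correction, which is also the upper left block of J⁻¹.

For the Lipschitz bound, write M_d = `condensedInv d`. The identity M_d - M_e = M_d (E - D) M_e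
reduces the matter to |d_k - e_k|, which C_f controls once the weights lie in S_k. On K⁰ all
Laguerre cells are nonempty, so coordinates of ψ differ by at most 2‖c‖_∞; a pigeonhole argument
bounds one slope on each side, hence all of them (`optWeight_mem_slopeSet`).

If dom F is a single point, F* is affine and its Hessian vanishes. -/

/-- The standing assumptions on one summand of a splitting storage fee. -/
structure IsFeeComponent (f : ℝ → EReal) (η : ℝ) : Prop where
  closedConvex : IsProperClosedConvex f
  effDom_subset_unit : effDom f ⊆ Icc 0 1
  essSmooth : IsEssentiallySmooth f
  d1_differentiableOn : DifferentiableOn ℝ (d1 f) (intDom f)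
  d2_locallyLipschitzOn : LocallyLipschitzOn (intDom f) (d2 f)
  eta_pos : 0 < η
  eta_le_d2 : ∀ x ∈ intDom f, η ≤ d2 f x

/-- The inverse of the derivative of a fee component. -/
noncomputable def slopeInv (f : ℝ → EReal) : ℝ → ℝ := Function.invFunOn (d1 f) (intDom f)

/-! ### One-variable fees: the derivative as a bijection from the open domain onto ℝ -/

namespace IsFeeComponent

variable {f : ℝ → EReal} {η : ℝ}

lemma coe_toReal (hf : IsFeeComponent f η) {x : ℝ} (hx : x ∈ effDom f) :
    (((f x).toReal : ℝ) : EReal) = f x :=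
  EReal.coe_toReal (ne_of_lt hx) (hf.closedConvex.proper.1 x)

lemma convexOn_toReal (hf : IsFeeComponent f η) :
    ConvexOn ℝ (effDom f) fun x => (f x).toReal := by
  have key : ∀ x ∈ effDom f, ∀ z ∈ effDom f, ∀ a b : ℝ, 0 ≤ a → 0 ≤ b → a + b = 1 →
      f (a • x + b • z) ≤ ((a • (f x).toReal + b • (f z).toReal : ℝ) : EReal) := by
    intro x hx z hz a b ha hb hab
    exact hf.closedConvex.convex (x := (x, (f x).toReal)) (hf.coe_toReal hx).ge
      (y := (z, (f z).toReal)) (hf.coe_toReal hz).ge ha hb hab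
  have hdom : Convex ℝ (effDom f) := fun x hx z hz a b ha hb hab =>
    (key x hx z hz a b ha hb hab).trans_lt (EReal.coe_lt_top _)
  refine ⟨hdom, fun x hx z hz a b ha hb hab => ?_⟩
  have h := key x hx z hz a b ha hb hab
  rw [← hf.coe_toReal (hdom hx hz ha hb hab)] at h
  exact EReal.coe_le_coe_iff.1 h

lemma intDom_subset : intDom f ⊆ effDom f := interior_subset

lemma effDom_subset (hf : IsFeeComponent f η) : effDom f ⊆ Icc (leftEnd f) (rightEnd f) :=
  fun _ hx => ⟨csInf_le (bddBelow_Icc.mono hf.effDom_subset_unit) hx,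
    le_csSup (bddAbove_Icc.mono hf.effDom_subset_unit) hx⟩

lemma intDom_eq (hf : IsFeeComponent f η) : intDom f = Ioo (leftEnd f) (rightEnd f) := by
  refine Subset.antisymm ?_ ?_
  · rw [← interior_Icc]
    exact interior_mono hf.effDom_subset
  · refine interior_maximal (fun x hx => ?_) isOpen_Ioo
    obtain ⟨u, hu, hux⟩ := exists_lt_of_csInf_lt hf.closedConvex.proper.2 hx.1
    obtain ⟨v, hv, hxv⟩ := exists_lt_of_lt_csSup hf.closedConvex.proper.2 hx.2
    exact hf.convexOn_toReal.1.ordConnected.out hu hv ⟨hux.le, hxv.le⟩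

lemma isOpen_intDom : IsOpen (intDom f) := isOpen_interior

lemma convex_intDom (hf : IsFeeComponent f η) : Convex ℝ (intDom f) :=
  hf.intDom_eq ▸ convex_Ioo _ _

lemma leftEnd_lt_rightEnd (hf : IsFeeComponent f η) : leftEnd f < rightEnd f := by
  obtain ⟨x, hx⟩ := hf.essSmooth.1
  rw [hf.intDom_eq] at hx
  exact hx.1.trans hx.2

lemma tangent_le (hf : IsFeeComponent f η) {x z : ℝ} (hx : x ∈ intDom f) (hz : z ∈ effDom f) :
    (f x).toReal + d1 f x * (z - x) ≤ (f z).toReal := by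
  have hd : DifferentiableAt ℝ (fun x => (f x).toReal) x :=
    (hf.essSmooth.2.1 x hx).differentiableAt (isOpen_intDom.mem_nhds hx)
  rcases lt_trichotomy x z with h | rfl | h
  · have := hf.convexOn_toReal.deriv_le_slope (intDom_subset hx) hz h hd
    rw [slope_def_field, le_div_iff₀ (sub_pos.2 h)] at this
    simp only [d1]
    linarith
  · simp
  · have := hf.convexOn_toReal.slope_le_deriv hz (intDom_subset hx) h hd
    rw [slope_def_field, div_le_iff₀ (sub_pos.2 h)] at this
    simp only [d1]
    linarith

lemma mul_sub_le_d1_sub (hf : IsFeeComponent f η) {x z : ℝ} (hx : x ∈ intDom f)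
    (hz : z ∈ intDom f) (hxz : x ≤ z) : η * (z - x) ≤ d1 f z - d1 f x := by
  refine hf.convex_intDom.mul_sub_le_image_sub_of_le_deriv hf.d1_differentiableOn.continuousOn
    ?_ ?_ x hx z hz hxz
  · exact hf.d1_differentiableOn.mono interior_subset
  · exact fun u hu => hf.eta_le_d2 u (interior_subset hu)

lemma d1_strictMonoOn (hf : IsFeeComponent f η) : StrictMonoOn (d1 f) (intDom f) := by
  intro x hx z hz hxz
  have := hf.mul_sub_le_d1_sub hx hz hxz.le
  have := mul_pos hf.eta_pos (sub_pos.2 hxz)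
  linarith

lemma eta_mul_sq_le (hf : IsFeeComponent f η) {x z : ℝ} (hx : x ∈ intDom f)
    (hz : z ∈ intDom f) : η * (z - x) ^ 2 ≤ (d1 f z - d1 f x) * (z - x) := by
  rcases le_total x z with h | h
  · nlinarith [hf.mul_sub_le_d1_sub hx hz h]
  · nlinarith [hf.mul_sub_le_d1_sub hz hx h]

/-- Essential smoothness only gives |f'| → ∞ at the left end. Monotonicity bounds f' above there by
its midpoint value, so the divergence is towards -∞. -/
lemma exists_d1_le (hf : IsFeeComponent f η) (u : ℝ) : ∃ x ∈ intDom f, d1 f x ≤ u := by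
  by_contra! hcon
  have hab := sub_pos.2 hf.leftEnd_lt_rightEnd
  set a := leftEnd f with ha
  set b := rightEnd f with hb
  have hm : ∀ m : ℕ, (0 : ℝ) < 1 / ((m : ℝ) + 1) / 2 ∧ 1 / ((m : ℝ) + 1) / 2 ≤ 1 / 2 := by
    intro m
    have : (1 : ℝ) / ((m : ℝ) + 1) ≤ 1 := by
      rw [div_le_one (by positivity)]
      simp
    exact ⟨by positivity, by linarith⟩
  -- The factor 1/2 keeps the sequence in the left half of the domain, where it can be compared with
  -- the midpoint.
  have hmem : ∀ m : ℕ, a + (b - a) * (1 / ((m : ℝ) + 1) / 2) ∈ intDom f := by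
    intro m
    rw [hf.intDom_eq]
    constructor <;> nlinarith [hm m]
  have hmid : a + (b - a) * (1 / 2) ∈ intDom f := by
    rw [hf.intDom_eq]
    constructor <;> nlinarith
  have hlim : Tendsto (fun m : ℕ => a + (b - a) * (1 / ((m : ℝ) + 1) / 2)) atTop (𝓝 a) := by
    have := ((tendsto_one_div_add_atTop_nhds_zero_nat (𝕜 := ℝ)).div_const 2).const_mul (b - a)
    simpa using this.const_add a
  have hT := hf.essSmooth.2.2 _ a hmem
    (by rw [hf.intDom_eq, frontier_Ioo hf.leftEnd_lt_rightEnd]; simp [ha]) hlim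
  obtain ⟨m, hm'⟩ := (hT.eventually_gt_atTop (max |u| |d1 f (a + (b - a) * (1 / 2))|)).exists
  have h1 := hcon _ (hmem m)
  have h2 := hf.d1_strictMonoOn.monotoneOn (hmem m) hmid (by nlinarith [hm m])
  exact absurd (abs_le_max_abs_abs h1.le h2) (not_le.2 hm')

lemma exists_le_d1 (hf : IsFeeComponent f η) (u : ℝ) : ∃ x ∈ intDom f, u ≤ d1 f x := by
  by_contra! hcon
  have hab := sub_pos.2 hf.leftEnd_lt_rightEnd
  set a := leftEnd f with ha
  set b := rightEnd f with hb
  have hm : ∀ m : ℕ, (0 : ℝ) < 1 / ((m : ℝ) + 1) / 2 ∧ 1 / ((m : ℝ) + 1) / 2 ≤ 1 / 2 := by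
    intro m
    have : (1 : ℝ) / ((m : ℝ) + 1) ≤ 1 := by
      rw [div_le_one (by positivity)]
      simp
    exact ⟨by positivity, by linarith⟩
  have hmem : ∀ m : ℕ, b - (b - a) * (1 / ((m : ℝ) + 1) / 2) ∈ intDom f := by
    intro m
    rw [hf.intDom_eq]
    constructor <;> nlinarith [hm m]
  have hmid : b - (b - a) * (1 / 2) ∈ intDom f := by
    rw [hf.intDom_eq]
    constructor <;> nlinarith
  have hlim : Tendsto (fun m : ℕ => b - (b - a) * (1 / ((m : ℝ) + 1) / 2)) atTop (𝓝 b) := by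
    have := ((tendsto_one_div_add_atTop_nhds_zero_nat (𝕜 := ℝ)).div_const 2).const_mul (b - a)
    simpa using this.const_sub b
  have hT := hf.essSmooth.2.2 _ b hmem
    (by rw [hf.intDom_eq, frontier_Ioo hf.leftEnd_lt_rightEnd]; simp [hb]) hlim
  obtain ⟨m, hm'⟩ := (hT.eventually_gt_atTop (max |d1 f (b - (b - a) * (1 / 2))| |u|)).exists
  have h1 := hcon _ (hmem m)
  have h2 := hf.d1_strictMonoOn.monotoneOn hmid (hmem m) (by nlinarith [hm m])
  exact absurd (abs_le_max_abs_abs h2 h1.le) (not_le.2 hm')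

lemma d1_surjOn (hf : IsFeeComponent f η) (u : ℝ) : ∃ x ∈ intDom f, d1 f x = u := by
  obtain ⟨x, hx, hxu⟩ := hf.exists_d1_le u
  obtain ⟨z, hz, hzu⟩ := hf.exists_le_d1 u
  exact hf.convex_intDom.isPreconnected.intermediate_value hx hz
    hf.d1_differentiableOn.continuousOn ⟨hxu, hzu⟩

lemma slopeInv_mem (hf : IsFeeComponent f η) (u : ℝ) : slopeInv f u ∈ intDom f :=
  Function.invFunOn_mem (hf.d1_surjOn u)

lemma d1_slopeInv (hf : IsFeeComponent f η) (u : ℝ) : d1 f (slopeInv f u) = u :=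
  Function.invFunOn_eq (hf.d1_surjOn u)

lemma slopeInv_d1 (hf : IsFeeComponent f η) {x : ℝ} (hx : x ∈ intDom f) :
    slopeInv f (d1 f x) = x :=
  hf.d1_strictMonoOn.injOn (hf.slopeInv_mem _) hx (hf.d1_slopeInv _)

lemma slopeInv_strictMono (hf : IsFeeComponent f η) : StrictMono (slopeInv f) := by
  intro u v huv
  rw [← hf.d1_strictMonoOn.lt_iff_lt (hf.slopeInv_mem u) (hf.slopeInv_mem v),
    hf.d1_slopeInv, hf.d1_slopeInv]
  exact huv

lemma slopeInv_sub_le (hf : IsFeeComponent f η) {u v : ℝ} (huv : u ≤ v) :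
    slopeInv f v - slopeInv f u ≤ η⁻¹ * (v - u) := by
  have := hf.mul_sub_le_d1_sub (hf.slopeInv_mem u) (hf.slopeInv_mem v)
    (hf.slopeInv_strictMono.monotone huv)
  rw [hf.d1_slopeInv, hf.d1_slopeInv] at this
  rwa [inv_mul_eq_div, le_div_iff₀ hf.eta_pos, mul_comm]

lemma continuous_slopeInv (hf : IsFeeComponent f η) : Continuous (slopeInv f) := by
  refine (LipschitzWith.of_dist_le_mul (K := ⟨η⁻¹, inv_nonneg.2 hf.eta_pos.le⟩) ?_).continuous
  intro u v
  simp only [Real.dist_eq]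
  rcases le_total u v with h | h
  · rw [abs_sub_comm, abs_sub_comm u v, abs_of_nonneg (sub_nonneg.2 h),
      abs_of_nonneg (sub_nonneg.2 (hf.slopeInv_strictMono.monotone h))]
    exact hf.slopeInv_sub_le h
  · rw [abs_of_nonneg (sub_nonneg.2 h),
      abs_of_nonneg (sub_nonneg.2 (hf.slopeInv_strictMono.monotone h))]
    exact hf.slopeInv_sub_le h

lemma d2_pos (hf : IsFeeComponent f η) {x : ℝ} (hx : x ∈ intDom f) : 0 < d2 f x :=
  hf.eta_pos.trans_le (hf.eta_le_d2 x hx)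

/-- Inverse function rule: the inverse is continuous and f'' does not vanish. -/
lemma hasDerivAt_slopeInv (hf : IsFeeComponent f η) (u : ℝ) :
    HasDerivAt (slopeInv f) (d2 f (slopeInv f u))⁻¹ u := by
  refine HasDerivAt.of_local_left_inverse hf.continuous_slopeInv.continuousAt ?_
    (hf.d2_pos (hf.slopeInv_mem u)).ne' (Eventually.of_forall hf.d1_slopeInv)
  exact ((hf.d1_differentiableOn _ (hf.slopeInv_mem u)).differentiableAt
    (isOpen_intDom.mem_nhds (hf.slopeInv_mem u))).hasDerivAt

lemma continuousOn_d2 (hf : IsFeeComponent f η) : ContinuousOn (d2 f) (intDom f) :=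
  hf.d2_locallyLipschitzOn.continuousOn

/-- This is the source of compactness of S_i: it is a continuous image of a compact interval. -/
lemma setOf_abs_d1_le_eq_image (hf : IsFeeComponent f η) (K : ℝ) :
    {x ∈ intDom f | |d1 f x| ≤ K} = slopeInv f '' Icc (-K) K := by
  ext x
  constructor
  · rintro ⟨hx, hK⟩
    exact ⟨d1 f x, abs_le.1 hK, hf.slopeInv_d1 hx⟩
  · rintro ⟨u, hu, rfl⟩
    exact ⟨hf.slopeInv_mem u, by rw [hf.d1_slopeInv]; exact abs_le.2 hu⟩

lemma isCompact_setOf_abs_d1_le (hf : IsFeeComponent f η) (K : ℝ) :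
    IsCompact {x ∈ intDom f | |d1 f x| ≤ K} := by
  rw [hf.setOf_abs_d1_le_eq_image]
  exact isCompact_Icc.image hf.continuous_slopeInv

end IsFeeComponent

/-! ### Finiteness of the Lipschitz constant C_f -/

section Constants

variable {N : ℕ} {f : Fin N → ℝ → EReal} {η : ℝ}

lemma isCompact_slopeSet (hf : ∀ i, IsFeeComponent (f i) η) (M : ℝ) (i : Fin N) :
    IsCompact (slopeSet f M i) :=
  (hf i).isCompact_setOf_abs_d1_le _

lemma bddAbove_quotientSet (hf : ∀ i, IsFeeComponent (f i) η) (M : ℝ) (i : Fin N) :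
    BddAbove (quotientSet f M i) := by
  obtain ⟨K, hK⟩ := ((hf i).d2_locallyLipschitzOn.mono
    (fun _ hx => hx.1 : slopeSet f M i ⊆ _)).exists_lipschitzOnWith_of_compact
    (isCompact_slopeSet hf M i)
  refine ⟨K, ?_⟩
  rintro q ⟨x, hx, z, hz, rfl⟩
  have h := hK.dist_le_mul x hx z hz
  rw [Real.dist_eq, Real.dist_eq] at h
  -- This form of the division bound also covers x = z, where the quotient is 0 / 0 = 0.
  exact div_le_of_le_mul₀ (abs_nonneg _) K.2 h

lemma lipConst_nonneg (f : Fin N → ℝ → EReal) (M : ℝ) : 0 ≤ lipConst f M := by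
  refine Real.iSup_nonneg fun i => Real.sSup_nonneg ?_
  rintro q ⟨x, -, z, -, rfl⟩
  positivity

lemma abs_d2_sub_le (hf : ∀ i, IsFeeComponent (f i) η) {M : ℝ} {i : Fin N} {x z : ℝ}
    (hx : x ∈ slopeSet f M i) (hz : z ∈ slopeSet f M i) :
    |d2 (f i) x - d2 (f i) z| ≤ lipConst f M * |x - z| := by
  rcases eq_or_ne x z with rfl | hne
  · simp
  rw [← div_le_iff₀ (abs_pos.2 (sub_ne_zero.2 hne))]
  exact (le_csSup (bddAbove_quotientSet hf M i) ⟨x, hx, z, hz, rfl⟩).trans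
    (le_ciSup (f := fun i => sSup (quotientSet f M i)) (Set.finite_range _).bddAbove i)

end Constants

/-! ### The maximizer, its multiplier and their derivatives -/

/-- Carathéodory's criterion for differentiability at a point. -/
lemma hasFDerivAt_of_sub_eq_apply_sub {E F : Type*} [NormedAddCommGroup E] [NormedSpace ℝ E]
    [NormedAddCommGroup F] [NormedSpace ℝ F] {g : E → F} {L : E → E →L[ℝ] F} {x : E}
    (hL : ContinuousAt L x) (h : ∀ z, g z - g x = L z (z - x)) : HasFDerivAt g (L x) x := by
  rw [hasFDerivAt_iff_isLittleO, Asymptotics.isLittleO_iff]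
  intro ε hε
  filter_upwards [Metric.continuousAt_iff'.1 hL ε hε] with z hz
  rw [h, ← sub_apply]
  rw [dist_eq_norm] at hz
  exact (ContinuousLinearMap.le_opNorm _ _).trans (by gcongr)

/-- Fee components whose domains allow an interior point on the unit simplex. -/
structure IsInteriorFee {N : ℕ} (f : Fin N → ℝ → EReal) (η : ℝ) : Prop where
  component : ∀ i, IsFeeComponent (f i) η
  exists_interior : ∃ w : Fin N → ℝ, (∀ i, w i ∈ intDom (f i)) ∧ ∑ i, w i = 1

/-- The Lagrange multiplier of the constraint `∑ w i = 1`. -/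
noncomputable def multiplier {N : ℕ} (f : Fin N → ℝ → EReal) (ψ : EuclideanSpace ℝ (Fin N)) : ℝ :=
  Classical.epsilon fun r => ∑ i, slopeInv (f i) (ψ i - r) = 1

/-- The maximizer in the conjugate of a splitting fee. -/
noncomputable def optWeight {N : ℕ} (f : Fin N → ℝ → EReal) (ψ : EuclideanSpace ℝ (Fin N)) :
    EuclideanSpace ℝ (Fin N) :=
  WithLp.toLp 2 fun i => slopeInv (f i) (ψ i - multiplier f ψ)

/-- The second derivatives of the fee components at the maximizer. -/
noncomputable def optCurv {N : ℕ} (f : Fin N → ℝ → EReal) (ψ : EuclideanSpace ℝ (Fin N)) :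
    Fin N → ℝ := fun i => d2 (f i) (optWeight f ψ i)

/-- The upper left block of the inverse of the bordered matrix with diagonal `d`. -/
noncomputable def condensedInv {N : ℕ} (d : Fin N → ℝ) : Matrix (Fin N) (Fin N) ℝ :=
  Matrix.diagonal d⁻¹ - (∑ i, (d i)⁻¹)⁻¹ • Matrix.vecMulVec d⁻¹ d⁻¹

namespace IsInteriorFee

variable {N : ℕ} {f : Fin N → ℝ → EReal} {η : ℝ}

lemma nonempty_index (hf : IsInteriorFee f η) : Nonempty (Fin N) := by
  obtain ⟨w, -, hw⟩ := hf.exists_interior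
  by_contra h
  rw [not_nonempty_iff] at h
  simp at hw

/-- Intermediate value theorem in r: compare each inverse slope with the coordinate w i of a
feasible interior point. -/
lemma exists_multiplier (hf : IsInteriorFee f η) (ψ : EuclideanSpace ℝ (Fin N)) :
    ∃ r, ∑ i, slopeInv (f i) (ψ i - r) = 1 := by
  obtain ⟨w, hw, hw1⟩ := hf.exists_interior
  have hcont : Continuous fun r : ℝ => ∑ i, slopeInv (f i) (ψ i - r) :=
    continuous_finsetSum _ fun i _ =>
      (hf.component i).continuous_slopeInv.comp (continuous_const.sub continuous_id)
  -- For r = s every slope ψ i - r is at most f_i'(w i), so the weights sum to at most 1; the lower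
  -- bound t gives the reverse.
  obtain ⟨s, hs⟩ := (Set.finite_range fun i => ψ i - d1 (f i) (w i)).bddAbove
  obtain ⟨t, ht⟩ := (Set.finite_range fun i => ψ i - d1 (f i) (w i)).bddBelow
  refine mem_range_of_exists_le_of_exists_ge hcont ⟨s, ?_⟩ ⟨t, ?_⟩
  · rw [← hw1]
    refine Finset.sum_le_sum fun i _ => ?_
    rw [← (hf.component i).slopeInv_d1 (hw i)]
    have := hs (mem_range_self i)
    exact (hf.component i).slopeInv_strictMono.monotone
      (by linarith)
  · rw [← hw1]
    refine Finset.sum_le_sum fun i _ => ?_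
    rw [← (hf.component i).slopeInv_d1 (hw i)]
    have := ht (mem_range_self i)
    exact (hf.component i).slopeInv_strictMono.monotone
      (by linarith)

lemma optWeight_sum (hf : IsInteriorFee f η) (ψ : EuclideanSpace ℝ (Fin N)) :
    ∑ i, optWeight f ψ i = 1 :=
  Classical.epsilon_spec (hf.exists_multiplier ψ)

lemma optWeight_mem (hf : IsInteriorFee f η) (ψ : EuclideanSpace ℝ (Fin N)) (i : Fin N) :
    optWeight f ψ i ∈ intDom (f i) :=
  (hf.component i).slopeInv_mem _

lemma d1_optWeight (hf : IsInteriorFee f η) (ψ : EuclideanSpace ℝ (Fin N)) (i : Fin N) :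
    d1 (f i) (optWeight f ψ i) = ψ i - multiplier f ψ :=
  (hf.component i).d1_slopeInv _

lemma optCurv_pos (hf : IsInteriorFee f η) (ψ : EuclideanSpace ℝ (Fin N)) (i : Fin N) :
    0 < optCurv f ψ i :=
  (hf.component i).d2_pos (hf.optWeight_mem ψ i)

lemma eta_pos (hf : IsInteriorFee f η) : 0 < η := by
  obtain ⟨i⟩ := hf.nonempty_index
  exact (hf.component i).eta_pos

/-- Strong monotonicity of the f_i', summed over i. The multipliers drop out because both weight
vectors have sum 1. -/
lemma eta_mul_norm_optWeight_sub_le (hf : IsInteriorFee f η) (φ ψ : EuclideanSpace ℝ (Fin N)) :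
    η * ‖optWeight f φ - optWeight f ψ‖ ≤ ‖φ - ψ‖ := by
  set v := optWeight f φ - optWeight f ψ with hv
  have h1 : η * ‖v‖ ^ 2 ≤ inner ℝ v (φ - ψ) := by
    have hsum : ∑ i, (optWeight f φ i - optWeight f ψ i) = 0 := by
      rw [Finset.sum_sub_distrib, hf.optWeight_sum, hf.optWeight_sum, sub_self]
    have e : inner ℝ v (φ - ψ) = ∑ i, (d1 (f i) (optWeight f φ i) - d1 (f i) (optWeight f ψ i))
        * (optWeight f φ i - optWeight f ψ i) := by
      have : ∀ i, (d1 (f i) (optWeight f φ i) - d1 (f i) (optWeight f ψ i))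
          * (optWeight f φ i - optWeight f ψ i) = (φ i - ψ i) * (optWeight f φ i - optWeight f ψ i)
          - (multiplier f φ - multiplier f ψ) * (optWeight f φ i - optWeight f ψ i) := by
        intro i
        rw [hf.d1_optWeight, hf.d1_optWeight]
        ring
      simp_rw [this]
      rw [Finset.sum_sub_distrib, ← Finset.mul_sum, hsum, mul_zero, sub_zero, PiLp.inner_apply]
      simp [hv]
    rw [e, EuclideanSpace.norm_sq_eq, Finset.mul_sum]
    refine Finset.sum_le_sum fun i _ => ?_
    rw [Real.norm_eq_abs, sq_abs]
    exact (hf.component i).eta_mul_sq_le (hf.optWeight_mem ψ i) (hf.optWeight_mem φ i)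
  have h2 := h1.trans (real_inner_le_norm _ _)
  rcases (norm_nonneg v).eq_or_lt with h | h
  · rw [← h, mul_zero]
    exact norm_nonneg _
  · nlinarith

lemma norm_optWeight_sub_le (hf : IsInteriorFee f η) (φ ψ : EuclideanSpace ℝ (Fin N)) :
    ‖optWeight f φ - optWeight f ψ‖ ≤ η⁻¹ * ‖φ - ψ‖ := by
  rw [inv_mul_eq_div, le_div_iff₀ hf.eta_pos, mul_comm]
  exact hf.eta_mul_norm_optWeight_sub_le φ ψ

lemma continuous_optWeight (hf : IsInteriorFee f η) : Continuous (optWeight f) := by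
  refine (LipschitzWith.of_dist_le_mul (K := ⟨η⁻¹, inv_nonneg.2 hf.eta_pos.le⟩) ?_).continuous
  intro φ ψ
  simp only [dist_eq_norm]
  exact hf.norm_optWeight_sub_le φ ψ

lemma continuous_optWeight_apply (hf : IsInteriorFee f η) (i : Fin N) :
    Continuous fun ψ => optWeight f ψ i :=
  (EuclideanSpace.proj (𝕜 := ℝ) i).continuous.comp hf.continuous_optWeight

lemma continuous_multiplier (hf : IsInteriorFee f η) : Continuous (multiplier f) := by
  obtain ⟨i⟩ := hf.nonempty_index
  have : multiplier f = fun ψ => ψ i - d1 (f i) (optWeight f ψ i) := by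
    ext ψ
    rw [hf.d1_optWeight]
    ring
  rw [this]
  exact (EuclideanSpace.proj (𝕜 := ℝ) i).continuous.sub
    ((hf.component i).d1_differentiableOn.continuousOn.comp_continuous
      (hf.continuous_optWeight_apply i) fun ψ => hf.optWeight_mem ψ i)

lemma continuous_optCurv (hf : IsInteriorFee f η) : Continuous (optCurv f) :=
  continuous_pi fun i => (hf.component i).continuousOn_d2.comp_continuous
    (hf.continuous_optWeight_apply i) fun ψ => hf.optWeight_mem ψ i

lemma sum_inv_optCurv_pos (hf : IsInteriorFee f η) (ψ : EuclideanSpace ℝ (Fin N)) :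
    0 < ∑ i, (optCurv f ψ i)⁻¹ := by
  have := hf.nonempty_index
  exact Finset.sum_pos (fun i _ => inv_pos.2 (hf.optCurv_pos ψ i)) Finset.univ_nonempty

/-- Replacing derivatives of the inverse slopes by difference quotients turns the constraint into an
exact linear relation: the increment of r is the average of the increments of ψ^i with positive
weights q_i. These weights are continuous at ψ, so Carathéodory's criterion applies. -/
lemma hasFDerivAt_multiplier (hf : IsInteriorFee f η) (ψ : EuclideanSpace ℝ (Fin N)) :
    HasFDerivAt (multiplier f) ((∑ i, (optCurv f ψ i)⁻¹)⁻¹ •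
      ∑ i, (optCurv f ψ i)⁻¹ • EuclideanSpace.proj (𝕜 := ℝ) i) ψ := by
  have hne := hf.nonempty_index
  -- `dslope` takes the value of the derivative when the two arguments agree, which can happen even
  -- for φ ≠ ψ.
  set q : EuclideanSpace ℝ (Fin N) → Fin N → ℝ := fun φ i =>
    dslope (slopeInv (f i)) (ψ i - multiplier f ψ) (φ i - multiplier f φ) with hq
  have hqψ : ∀ i, q ψ i = (optCurv f ψ i)⁻¹ := by
    intro i
    simp only [hq, dslope_same]
    exact ((hf.component i).hasDerivAt_slopeInv _).deriv
  have hqpos : ∀ φ i, 0 < q φ i := by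
    intro φ i
    rcases eq_or_ne (φ i - multiplier f φ) (ψ i - multiplier f ψ) with h | h
    · simp only [hq, h, dslope_same]
      rw [((hf.component i).hasDerivAt_slopeInv _).deriv]
      exact inv_pos.2 (hf.optCurv_pos ψ i)
    · simp only [hq, dslope_of_ne _ h, slope_def_field]
      rcases h.lt_or_gt with h | h
      · exact div_pos_of_neg_of_neg
          (sub_neg.2 ((hf.component i).slopeInv_strictMono h)) (sub_neg.2 h)
      · exact div_pos (sub_pos.2 ((hf.component i).slopeInv_strictMono h)) (sub_pos.2 h)
  have hqsum : ∀ φ, 0 < ∑ i, q φ i := fun φ =>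
    Finset.sum_pos (fun i _ => hqpos φ i) Finset.univ_nonempty
  have hqcont : ∀ i, ContinuousAt (fun φ => q φ i) ψ := by
    intro i
    refine ContinuousAt.comp (f := fun φ : EuclideanSpace ℝ (Fin N) => φ i - multiplier f φ)
      (g := dslope (slopeInv (f i)) (ψ i - multiplier f ψ)) ?_ ?_
    · exact continuousAt_dslope_same.2 ((hf.component i).hasDerivAt_slopeInv _).differentiableAt
    · exact ((EuclideanSpace.proj (𝕜 := ℝ) i).continuous.sub hf.continuous_multiplier).continuousAt
  have hmain := hasFDerivAt_of_sub_eq_apply_sub (g := multiplier f) (x := ψ)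
    (L := fun φ => (∑ i, q φ i)⁻¹ • ∑ i, q φ i • EuclideanSpace.proj (𝕜 := ℝ) i) ?_ ?_
  · simpa only [hqψ] using hmain
  · have h1 : ContinuousAt (fun φ => ∑ i, q φ i) ψ := tendsto_finsetSum _ fun i _ => hqcont i
    have h2 : ContinuousAt (fun φ => ∑ i, q φ i •
        (EuclideanSpace.proj i : EuclideanSpace ℝ (Fin N) →L[ℝ] ℝ)) ψ :=
      tendsto_finsetSum _ fun i _ => (hqcont i).smul continuousAt_const
    exact (h1.inv₀ (hqsum ψ).ne').smul h2
  · intro φ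
    -- Each summand is an increment of a weight, and the weights always sum to 1.
    have h0 : ∑ i, ((φ i - multiplier f φ) - (ψ i - multiplier f ψ)) * q φ i = 0 := by
      have : ∀ i, ((φ i - multiplier f φ) - (ψ i - multiplier f ψ)) * q φ i
          = optWeight f φ i - optWeight f ψ i := fun i =>
        sub_smul_dslope (slopeInv (f i)) _ _
      simp_rw [this]
      rw [Finset.sum_sub_distrib, hf.optWeight_sum, hf.optWeight_sum, sub_self]
    have h1 : (multiplier f φ - multiplier f ψ) * ∑ i, q φ i = ∑ i, q φ i * (φ i - ψ i) := by
      rw [Finset.mul_sum, ← sub_eq_zero, ← Finset.sum_sub_distrib, ← neg_eq_zero,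
        ← Finset.sum_neg_distrib, ← h0]
      exact Finset.sum_congr rfl fun i _ => by ring
    have := (hqsum φ).ne'
    simp only [FunLike.coe_smul, FunLike.coe_sum, Pi.smul_apply, Finset.sum_apply,
      smul_eq_mul, PiLp.proj_apply, PiLp.sub_apply]
    rw [← h1]
    field_simp

lemma hasFDerivAt_optWeight (hf : IsInteriorFee f η) (ψ : EuclideanSpace ℝ (Fin N)) :
    HasFDerivAt (optWeight f)
      (Matrix.toEuclideanCLM (n := Fin N) (𝕜 := ℝ) (condensedInv (optCurv f ψ))) ψ := by
  rw [← hasFDerivWithinAt_univ, hasFDerivWithinAt_euclidean]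
  intro i
  rw [hasFDerivWithinAt_univ]
  have h := ((hf.component i).hasDerivAt_slopeInv (ψ i - multiplier f ψ)).comp_hasFDerivAt ψ
    ((EuclideanSpace.proj (𝕜 := ℝ) i).hasFDerivAt.sub (hf.hasFDerivAt_multiplier ψ))
  refine h.congr_fderiv ?_
  ext v
  have hd : d2 (f i) (slopeInv (f i) (ψ i - multiplier f ψ)) = optCurv f ψ i := rfl
  simp only [hd, FunLike.coe_smul, FunLike.coe_sub, FunLike.coe_sum, Pi.smul_apply, Pi.sub_apply,
    Finset.sum_apply, smul_eq_mul, ContinuousLinearMap.comp_apply,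
    PiLp.proj_apply, Matrix.ofLp_toEuclideanCLM, condensedInv, Matrix.sub_mulVec,
    Matrix.smul_mulVec, Matrix.vecMulVec_mulVec, Matrix.mulVec_diagonal, dotProduct, Pi.inv_apply]
  simp
  ring

lemma continuous_condensedInv_optCurv (hf : IsInteriorFee f η) :
    Continuous fun ψ => condensedInv (optCurv f ψ) := by
  have h : ∀ i, Continuous fun ψ => (optCurv f ψ i)⁻¹ := fun i =>
    ((continuous_apply i).comp hf.continuous_optCurv).inv₀ fun ψ => (hf.optCurv_pos ψ i).ne'
  have hv : Continuous fun ψ => (optCurv f ψ)⁻¹ := continuous_pi h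
  have hs : Continuous fun ψ => ∑ i, (optCurv f ψ i)⁻¹ := continuous_finsetSum _ fun i _ => h i
  exact hv.matrix_diagonal.sub
    ((hs.inv₀ fun ψ => (hf.sum_inv_optCurv_pos ψ).ne').smul (hv.matrix_vecMulVec hv))

lemma continuous_toEuclideanCLM_condensedInv (hf : IsInteriorFee f η) :
    Continuous fun ψ =>
      Matrix.toEuclideanCLM (n := Fin N) (𝕜 := ℝ) (condensedInv (optCurv f ψ)) :=
  (LinearMap.continuous_of_finiteDimensional
    (Matrix.toEuclideanCLM (n := Fin N) (𝕜 := ℝ)).toAlgEquiv.toLinearMap).comp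
    hf.continuous_condensedInv_optCurv

end IsInteriorFee

/-! ### The condensed inverse: entry bounds, difference identity, bordered matrix -/

section Matrices

variable {N : ℕ} {d e : Fin N → ℝ}

lemma condensedInv_apply (d : Fin N → ℝ) (i j : Fin N) :
    condensedInv d i j =
      (if i = j then (d i)⁻¹ else 0) - (∑ k, (d k)⁻¹)⁻¹ * ((d i)⁻¹ * (d j)⁻¹) := by
  simp [condensedInv, Matrix.diagonal_apply, Matrix.vecMulVec_apply]

lemma condensedInv_transpose (d : Fin N → ℝ) : (condensedInv d).transpose = condensedInv d := by
  ext i j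
  rw [Matrix.transpose_apply, condensedInv_apply, condensedInv_apply, mul_comm (d j)⁻¹]
  congr 1
  by_cases h : i = j
  · simp [h]
  · simp [h, Ne.symm h]

lemma condensedInv_row_sum (hd : ∑ k, (d k)⁻¹ ≠ 0) (i : Fin N) :
    ∑ j, condensedInv d i j = 0 := by
  simp_rw [condensedInv_apply]
  rw [Finset.sum_sub_distrib, ← Finset.mul_sum, ← Finset.mul_sum]
  rw [mul_left_comm, inv_mul_cancel₀ hd]
  simp

lemma diagonal_mul_condensedInv_apply (hd : ∀ i, d i ≠ 0) (i j : Fin N) :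
    d i * condensedInv d i j = (if i = j then 1 else 0) - (∑ k, (d k)⁻¹)⁻¹ * (d j)⁻¹ := by
  rw [condensedInv_apply]
  have := hd i
  split_ifs with h
  · subst h
    field_simp
  · rw [mul_sub, mul_zero, mul_left_comm, mul_inv_cancel_left₀ this]

lemma condensedInv_col_sum (hd : ∑ k, (d k)⁻¹ ≠ 0) (j : Fin N) :
    ∑ i, condensedInv d i j = 0 := by
  rw [← condensedInv_row_sum hd j]
  exact Finset.sum_congr rfl fun i _ => congrFun (congrFun (condensedInv_transpose d) j) i

/-- The rank-one correction lies between 0 and 1/d_i, since 1/d_j is one term of the sum it is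
divided by. -/
lemma abs_condensedInv_apply_le (hd : ∀ i, 0 < d i) (i j : Fin N) :
    |condensedInv d i j| ≤ (d i)⁻¹ := by
  rw [condensedInv_apply]
  have hp : ∀ k, 0 < (d k)⁻¹ := fun k => inv_pos.2 (hd k)
  have hle : (d j)⁻¹ ≤ ∑ k, (d k)⁻¹ :=
    Finset.single_le_sum (fun k _ => (hp k).le) (Finset.mem_univ j)
  have hP := (hp j).trans_le hle
  have h0 : 0 ≤ (∑ k, (d k)⁻¹)⁻¹ * ((d i)⁻¹ * (d j)⁻¹) :=
    mul_nonneg (inv_nonneg.2 hP.le) (mul_nonneg (hp i).le (hp j).le)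
  have h1 : (∑ k, (d k)⁻¹)⁻¹ * ((d i)⁻¹ * (d j)⁻¹) ≤ (d i)⁻¹ := by
    rw [inv_mul_le_iff₀ hP, mul_comm]
    exact mul_le_mul_of_nonneg_right hle (hp i).le
  split_ifs
  · rw [abs_le]
    constructor <;> linarith [hp i]
  · rw [zero_sub, abs_neg, abs_of_nonneg h0]
    exact h1

/-- A resolvent identity for singular matrices. E M_e differs from the identity by a matrix with
constant columns, which M_d annihilates because its rows sum to 0; thus M_d E M_e = M_d.
Symmetrically, M_d D M_e = M_e. -/
lemma condensedInv_sub_apply (hd : ∀ i, 0 < d i) (he : ∀ i, 0 < e i) (i j : Fin N) :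
    (condensedInv d - condensedInv e) i j =
      ∑ k, condensedInv d i k * (e k - d k) * condensedInv e k j := by
  have hsum : ∀ {c : Fin N → ℝ}, (∀ i, 0 < c i) → ∑ k, (c k)⁻¹ ≠ 0 := fun hc =>
    (Finset.sum_pos (fun k _ => inv_pos.2 (hc k)) ⟨i, Finset.mem_univ i⟩).ne'
  have h1 : ∑ k, condensedInv d i k * (e k * condensedInv e k j) = condensedInv d i j := by
    simp_rw [diagonal_mul_condensedInv_apply (fun i => (he i).ne'), mul_sub]
    rw [Finset.sum_sub_distrib, ← Finset.sum_mul, condensedInv_row_sum (hsum hd)]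
    simp
  have h2 : ∑ k, (d k * condensedInv d k i) * condensedInv e k j = condensedInv e i j := by
    simp_rw [diagonal_mul_condensedInv_apply (fun i => (hd i).ne'), sub_mul]
    rw [Finset.sum_sub_distrib, ← Finset.mul_sum, condensedInv_col_sum (hsum he)]
    simp
  rw [Matrix.sub_apply, ← h1, ← h2, ← Finset.sum_sub_distrib]
  refine Finset.sum_congr rfl fun k _ => ?_
  have : condensedInv d i k = condensedInv d k i :=
    congrFun (congrFun (condensedInv_transpose d) k) i
  rw [this]
  ring

lemma abs_condensedInv_sub_apply_le {η δ : ℝ} (hη : 0 < η) (hd : ∀ i, η ≤ d i)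
    (he : ∀ i, η ≤ e i) (hδ : ∀ i, |d i - e i| ≤ δ) (i j : Fin N) :
    |(condensedInv d - condensedInv e) i j| ≤ N * (η⁻¹ * δ * η⁻¹) := by
  have hdp : ∀ i, 0 < d i := fun i => hη.trans_le (hd i)
  have hep : ∀ i, 0 < e i := fun i => hη.trans_le (he i)
  rw [condensedInv_sub_apply hdp hep]
  have hterm : ∀ k ∈ Finset.univ, |condensedInv d i k * (e k - d k) * condensedInv e k j| ≤
      η⁻¹ * δ * η⁻¹ := by
    intro k _
    rw [abs_mul, abs_mul, abs_sub_comm]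
    have h1 := (abs_condensedInv_apply_le hdp i k).trans (inv_anti₀ hη (hd i))
    have h2 := (abs_condensedInv_apply_le hep k j).trans (inv_anti₀ hη (he k))
    have h3 := hδ k
    have h4 := (abs_nonneg _).trans h3
    have h5 := inv_nonneg.2 hη.le
    gcongr
  refine (Finset.abs_sum_le_sum_abs _ _).trans ((Finset.sum_le_sum hterm).trans ?_)
  simp

lemma frobNorm_le {A : Matrix (Fin N) (Fin N) ℝ} {m : ℝ} (hm : 0 ≤ m)
    (hA : ∀ i j, |A i j| ≤ m) : frobNorm A ≤ N * m := by
  refine Real.sqrt_le_iff.2 ⟨by positivity, ?_⟩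
  have : ∑ i, ∑ j, A i j ^ 2 ≤ ∑ _i : Fin N, ∑ _j : Fin N, m ^ 2 :=
    Finset.sum_le_sum fun i _ => Finset.sum_le_sum fun j _ => sq_le_sq' (neg_le_of_abs_le (hA i j))
      (le_of_abs_le (hA i j))
  refine this.trans (le_of_eq ?_)
  simp
  ring

/-- Only the existence of K matters: it serves the qualitative C^{2,1} claim, while the explicit
constant uses `frobNorm_le`. -/
lemma exists_norm_toEuclideanCLM_le (N : ℕ) :
    ∃ K : ℝ, 0 ≤ K ∧ ∀ (A : Matrix (Fin N) (Fin N) ℝ) (m : ℝ), (∀ i j, |A i j| ≤ m) →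
      ‖Matrix.toEuclideanCLM (n := Fin N) (𝕜 := ℝ) A‖ ≤ K * m := by
  refine ⟨∑ i, ∑ j, ‖Matrix.toEuclideanCLM (n := Fin N) (𝕜 := ℝ) (Matrix.single i j 1)‖,
    by positivity, fun A m hA => ?_⟩
  have hdec : A = ∑ i, ∑ j, A i j • Matrix.single i j (1 : ℝ) := by
    conv_lhs => rw [Matrix.matrix_eq_sum_single A]
    simp [Matrix.smul_single]
  conv_lhs => rw [hdec]
  simp_rw [map_sum, map_smul, Finset.sum_mul]
  refine (norm_sum_le _ _).trans (Finset.sum_le_sum fun i _ => (norm_sum_le _ _).trans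
    (Finset.sum_le_sum fun j _ => ?_))
  rw [norm_smul, mul_comm, Real.norm_eq_abs]
  exact mul_le_mul_of_nonneg_left (hA i j) (norm_nonneg _)

lemma bordered_mul_eq_one (hd : ∀ i, d i ≠ 0) (hsum : ∑ k, (d k)⁻¹ ≠ 0) :
    Matrix.fromBlocks (Matrix.diagonal d) (Matrix.of fun (_ : Fin N) (_ : Unit) => (1 : ℝ))
      (Matrix.of fun (_ : Unit) (_ : Fin N) => (1 : ℝ)) 0 *
    Matrix.fromBlocks (condensedInv d)
      (Matrix.of fun (i : Fin N) (_ : Unit) => (∑ k, (d k)⁻¹)⁻¹ * (d i)⁻¹)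
      (Matrix.of fun (_ : Unit) (j : Fin N) => (∑ k, (d k)⁻¹)⁻¹ * (d j)⁻¹)
      (Matrix.of fun (_ _ : Unit) => -(∑ k, (d k)⁻¹)⁻¹) = 1 := by
  rw [Matrix.fromBlocks_multiply, ← Matrix.fromBlocks_one]
  congr 1
  · ext i j
    rw [Matrix.add_apply, Matrix.diagonal_mul, diagonal_mul_condensedInv_apply hd]
    simp [Matrix.mul_apply, Matrix.one_apply]
  · ext i j
    have := hd i
    rw [Matrix.add_apply, Matrix.diagonal_mul, Matrix.of_apply, mul_left_comm, mul_inv_cancel₀ this]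
    simp [Matrix.mul_apply]
  · ext i j
    simp [Matrix.mul_apply, condensedInv_col_sum hsum]
  · ext i j
    simp [Matrix.mul_apply, ← Finset.mul_sum, hsum]

end Matrices

/-! ### The domain of a splitting fee and interior feasible points -/

section Split

variable {N : ℕ} {F : EuclideanSpace ℝ (Fin N) → EReal} {f : Fin N → ℝ → EReal} {η : ℝ}

lemma ereal_sum_ne_bot {ι : Type*} {s : Finset ι} {g : ι → EReal} (hg : ∀ i ∈ s, g i ≠ ⊥) :
    ∑ i ∈ s, g i ≠ ⊥ :=
  Finset.sum_induction g (· ≠ ⊥) (fun _ _ ha hb => EReal.add_ne_bot_iff.2 ⟨ha, hb⟩)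
    EReal.zero_ne_bot hg

lemma ereal_coe_sum {ι : Type*} (s : Finset ι) (g : ι → ℝ) :
    ((∑ i ∈ s, g i : ℝ) : EReal) = ∑ i ∈ s, (g i : EReal) := by
  classical
  induction s using Finset.induction_on with
  | empty => simp
  | insert a s ha ih => rw [Finset.sum_insert ha, Finset.sum_insert ha, EReal.coe_add, ih]

lemma SplitsInto.mem_of_mem_effDom (hs : SplitsInto F f) {w : EuclideanSpace ℝ (Fin N)}
    (hw : w ∈ effDom F) : w ∈ weightSet N ∧ ∀ i, w i ∈ effDom (f i) := by
  have hbot : ∀ i, f i (w i) ≠ ⊥ := fun i => (hs.1 i).1.proper.1 _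
  have hlt : ∑ i, f i (w i) + indicatorFn (weightSet N) w < ⊤ := hs.2 w ▸ hw
  have hmem : w ∈ weightSet N := by
    by_contra h
    rw [indicatorFn, if_neg h, EReal.add_top_of_ne_bot (ereal_sum_ne_bot fun i _ => hbot i)] at hlt
    exact lt_irrefl _ hlt
  refine ⟨hmem, fun i => ?_⟩
  rw [indicatorFn, if_pos hmem, add_zero, ← Finset.add_sum_erase _ _ (Finset.mem_univ i)] at hlt
  by_contra h
  have h' : f i (w i) = ⊤ := not_lt_top_iff.1 h
  rw [h', EReal.top_add_of_ne_bot (ereal_sum_ne_bot fun i _ => hbot i)] at hlt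
  exact lt_irrefl _ hlt

lemma SplitsInto.eq_coe (hs : SplitsInto F f) {w : EuclideanSpace ℝ (Fin N)}
    (hw : w ∈ weightSet N) (hwf : ∀ i, w i ∈ effDom (f i)) :
    F w = ((∑ i, (f i (w i)).toReal : ℝ) : EReal) := by
  rw [hs.2 w, indicatorFn, if_pos hw, add_zero, ereal_coe_sum]
  exact Finset.sum_congr rfl fun i _ =>
    (EReal.coe_toReal (ne_of_lt (hwf i)) ((hs.1 i).1.proper.1 _)).symm

/-- If ∑ a_i ≥ 1, every point of dom F has w^i = a_i for all i, leaving room for one point only;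
likewise for the b_i. -/
lemma SplitsInto.sum_leftEnd_lt_one_lt_sum_rightEnd (hs : SplitsInto F f)
    (hf : ∀ i, IsFeeComponent (f i) η) (hF : (effDom F).Nontrivial) :
    ∑ i, leftEnd (f i) < 1 ∧ 1 < ∑ i, rightEnd (f i) := by
  obtain ⟨u, hu, v, hv, huv⟩ := hF
  obtain ⟨hu1, hu2⟩ := hs.mem_of_mem_effDom hu
  obtain ⟨hv1, hv2⟩ := hs.mem_of_mem_effDom hv
  have hu3 := fun i => (hf i).effDom_subset (hu2 i)
  have hv3 := fun i => (hf i).effDom_subset (hv2 i)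
  constructor
  · by_contra! h
    refine huv (PiLp.ext fun i => ?_)
    have hu4 := (Finset.sum_eq_sum_iff_of_le fun i _ => (hu3 i).1).1
      (le_antisymm (Finset.sum_le_sum fun i _ => (hu3 i).1) (hu1.1.trans_le h)) i (Finset.mem_univ i)
    have hv4 := (Finset.sum_eq_sum_iff_of_le fun i _ => (hv3 i).1).1
      (le_antisymm (Finset.sum_le_sum fun i _ => (hv3 i).1) (hv1.1.trans_le h)) i (Finset.mem_univ i)
    exact hu4.symm.trans hv4
  · by_contra! h
    refine huv (PiLp.ext fun i => ?_)
    have hu4 := (Finset.sum_eq_sum_iff_of_le fun i _ => (hu3 i).2).1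
      (le_antisymm (Finset.sum_le_sum fun i _ => (hu3 i).2) (h.trans_eq hu1.1.symm))
      i (Finset.mem_univ i)
    have hv4 := (Finset.sum_eq_sum_iff_of_le fun i _ => (hv3 i).2).1
      (le_antisymm (Finset.sum_le_sum fun i _ => (hv3 i).2) (h.trans_eq hv1.1.symm))
      i (Finset.mem_univ i)
    exact hu4.trans hv4.symm

lemma isInteriorFee_of_sum_lt (hf : ∀ i, IsFeeComponent (f i) η)
    (ha : ∑ i, leftEnd (f i) < 1) (hb : 1 < ∑ i, rightEnd (f i)) : IsInteriorFee f η := by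
  refine ⟨hf, ?_⟩
  set a := ∑ i, leftEnd (f i)
  set b := ∑ i, rightEnd (f i)
  have hab : 0 < b - a := by linarith
  -- The parameter at which the segment from (a_i) to (b_i) crosses the hyperplane of sum 1.
  set t := (1 - a) / (b - a) with ht
  have ht0 : 0 < t := div_pos (by linarith) hab
  have ht1 : t < 1 := (div_lt_one hab).2 (by linarith)
  refine ⟨fun i => leftEnd (f i) + t * (rightEnd (f i) - leftEnd (f i)), fun i => ?_, ?_⟩
  · rw [(hf i).intDom_eq]
    have := sub_pos.2 (hf i).leftEnd_lt_rightEnd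
    constructor <;> nlinarith
  · rw [Finset.sum_add_distrib, ← Finset.mul_sum, Finset.sum_sub_distrib]
    change a + t * (b - a) = 1
    rw [ht, div_mul_cancel₀ _ hab.ne']
    ring

end Split

/-! ### Single-point domain: the conjugate is affine -/

section Degenerate

variable {N : ℕ} {F : EuclideanSpace ℝ (Fin N) → EReal} {w : EuclideanSpace ℝ (Fin N)}

lemma conjugate_of_effDom_eq_singleton (hF : IsProper F) (hw : effDom F = {w})
    (ψ : EuclideanSpace ℝ (Fin N)) :
    conjugate F ψ = ((inner ℝ w ψ - (F w).toReal : ℝ) : EReal) := by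
  have hFw : ((F w).toReal : EReal) = F w :=
    EReal.coe_toReal (ne_of_lt (hw ▸ mem_singleton w : w ∈ effDom F)) (hF.1 w)
  rw [EReal.coe_sub, hFw]
  refine le_antisymm (iSup_le fun x => ?_)
    (le_iSup (fun x => ((inner ℝ x ψ : ℝ) : EReal) - F x) w)
  by_cases hx : x = w
  · rw [hx]
  · have : F x = ⊤ := not_lt_top_iff.1 fun h => hx (hw ▸ h : x ∈ ({w} : Set _))
    rw [this, EReal.sub_top]
    exact bot_le

lemma conjugateReal_of_effDom_eq_singleton (hF : IsProper F) (hw : effDom F = {w}) :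
    conjugateReal F = fun ψ => innerSL ℝ w ψ - (F w).toReal := by
  ext ψ
  rw [conjugateReal, conjugate_of_effDom_eq_singleton hF hw, EReal.toReal_coe]
  rfl

lemma fderiv_fderiv_conjugateReal_of_effDom_eq_singleton (hF : IsProper F)
    (hw : effDom F = {w}) : fderiv ℝ (fderiv ℝ (conjugateReal F)) = 0 := by
  have : fderiv ℝ (conjugateReal F) = fun _ => innerSL ℝ w := by
    ext1 ψ
    rw [conjugateReal_of_effDom_eq_singleton hF hw, fderiv_sub_const]
    exact (innerSL ℝ w).fderiv
  rw [this]
  ext1 ψ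
  simp

end Degenerate

/-! ### The conjugate: value, gradient and Hessian -/

namespace IsInteriorFee

variable {N : ℕ} {F : EuclideanSpace ℝ (Fin N) → EReal} {f : Fin N → ℝ → EReal} {η : ℝ}

lemma optWeight_mem_weightSet (hf : IsInteriorFee f η) (ψ : EuclideanSpace ℝ (Fin N)) :
    optWeight f ψ ∈ weightSet N :=
  ⟨hf.optWeight_sum ψ, fun i =>
    ((hf.component i).effDom_subset_unit (IsFeeComponent.intDom_subset (hf.optWeight_mem ψ i))).1⟩

lemma fee_optWeight (hf : IsInteriorFee f η) (hs : SplitsInto F f)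
    (ψ : EuclideanSpace ℝ (Fin N)) :
    F (optWeight f ψ) = ((∑ i, (f i (optWeight f ψ i)).toReal : ℝ) : EReal) :=
  hs.eq_coe (hf.optWeight_mem_weightSet ψ) fun i =>
    IsFeeComponent.intDom_subset (hf.optWeight_mem ψ i)

/-- Lagrangian sufficiency: add the tangent inequalities with slopes ψ^i - r. The r-terms cancel
since both points have sum 1. -/
lemma inner_sub_le (hf : IsInteriorFee f η) (ψ : EuclideanSpace ℝ (Fin N))
    {x : EuclideanSpace ℝ (Fin N)} (hx : x ∈ weightSet N) (hxf : ∀ i, x i ∈ effDom (f i)) :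
    inner ℝ x ψ - ∑ i, (f i (x i)).toReal ≤
      inner ℝ (optWeight f ψ) ψ - ∑ i, (f i (optWeight f ψ i)).toReal := by
  have h : ∑ i, ((f i (optWeight f ψ i)).toReal +
      (ψ i - multiplier f ψ) * (x i - optWeight f ψ i)) ≤ ∑ i, (f i (x i)).toReal := by
    refine Finset.sum_le_sum fun i _ => ?_
    rw [← hf.d1_optWeight ψ i]
    exact (hf.component i).tangent_le (hf.optWeight_mem ψ i) (hxf i)
  have e : ∀ i, (ψ i - multiplier f ψ) * (x i - optWeight f ψ i) =
      ψ i * x i - ψ i * optWeight f ψ i - multiplier f ψ * (x i - optWeight f ψ i) := fun i => by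
    ring
  simp_rw [e] at h
  rw [Finset.sum_add_distrib, Finset.sum_sub_distrib, Finset.sum_sub_distrib, ← Finset.mul_sum,
    Finset.sum_sub_distrib, hf.optWeight_sum, hx.1] at h
  simp only [PiLp.inner_apply, RCLike.inner_apply, conj_trivial]
  linarith

lemma conjugate_eq (hf : IsInteriorFee f η) (hs : SplitsInto F f)
    (ψ : EuclideanSpace ℝ (Fin N)) :
    conjugate F ψ =
      ((inner ℝ (optWeight f ψ) ψ - ∑ i, (f i (optWeight f ψ i)).toReal : ℝ) : EReal) := by
  refine le_antisymm (iSup_le fun x => ?_) ?_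
  · by_cases hx : x ∈ effDom F
    · obtain ⟨h1, h2⟩ := hs.mem_of_mem_effDom hx
      rw [hs.eq_coe h1 h2, ← EReal.coe_sub, EReal.coe_le_coe_iff]
      exact hf.inner_sub_le ψ h1 h2
    · rw [(not_lt_top_iff.1 hx : F x = ⊤), EReal.sub_top]
      exact bot_le
  · rw [EReal.coe_sub, ← hf.fee_optWeight hs]
    exact le_iSup (fun x => ((inner ℝ x ψ : ℝ) : EReal) - F x) _

lemma conjugateReal_eq (hf : IsInteriorFee f η) (hs : SplitsInto F f)
    (ψ : EuclideanSpace ℝ (Fin N)) :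
    conjugateReal F ψ =
      inner ℝ (optWeight f ψ) ψ - ∑ i, (f i (optWeight f ψ i)).toReal := by
  rw [conjugateReal, hf.conjugate_eq hs, EReal.toReal_coe]

lemma coe_conjugateReal (hf : IsInteriorFee f η) (hs : SplitsInto F f)
    (ψ : EuclideanSpace ℝ (Fin N)) : ((conjugateReal F ψ : ℝ) : EReal) = conjugate F ψ := by
  rw [hf.conjugateReal_eq hs, hf.conjugate_eq hs]

lemma inner_optWeight_le (hf : IsInteriorFee f η) (hs : SplitsInto F f)
    (φ ψ : EuclideanSpace ℝ (Fin N)) :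
    inner ℝ (optWeight f ψ) (φ - ψ) ≤ conjugateReal F φ - conjugateReal F ψ := by
  have := hf.inner_sub_le φ (hf.optWeight_mem_weightSet ψ) fun i =>
    IsFeeComponent.intDom_subset (hf.optWeight_mem ψ i)
  rw [hf.conjugateReal_eq hs, hf.conjugateReal_eq hs, inner_sub_right]
  linarith

/-- The subgradient inequalities at ψ and at φ trap the remainder between 0 and ⟨w(φ) - w(ψ), φ - ψ⟩
≤ η⁻¹‖φ - ψ‖². -/
lemma hasFDerivAt_conjugateReal (hf : IsInteriorFee f η) (hs : SplitsInto F f)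
    (ψ : EuclideanSpace ℝ (Fin N)) :
    HasFDerivAt (conjugateReal F) (innerSL ℝ (optWeight f ψ)) ψ := by
  rw [hasFDerivAt_iff_isLittleO, Asymptotics.isLittleO_iff]
  intro ε hε
  filter_upwards [Metric.ball_mem_nhds ψ (mul_pos hε hf.eta_pos)] with φ hφ
  rw [Metric.mem_ball, dist_eq_norm] at hφ
  have h1 := hf.inner_optWeight_le hs φ ψ
  have h2 := hf.inner_optWeight_le hs ψ φ
  rw [← neg_sub φ ψ, inner_neg_right] at h2
  have h3 := real_inner_le_norm (optWeight f φ - optWeight f ψ) (φ - ψ)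
  rw [inner_sub_left] at h3
  have h4 := hf.norm_optWeight_sub_le φ ψ
  have h5 : η⁻¹ * ‖φ - ψ‖ ≤ ε := by
    rw [inv_mul_le_iff₀ hf.eta_pos, mul_comm]
    exact hφ.le
  have h6 := mul_le_mul_of_nonneg_right (h4.trans h5) (norm_nonneg (φ - ψ))
  rw [innerSL_apply_apply, Real.norm_eq_abs, abs_of_nonneg (by linarith)]
  linarith

lemma fderiv_conjugateReal (hf : IsInteriorFee f η) (hs : SplitsInto F f) :
    fderiv ℝ (conjugateReal F) = fun ψ => innerSL ℝ (optWeight f ψ) :=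
  funext fun ψ => (hf.hasFDerivAt_conjugateReal hs ψ).fderiv

lemma gradient_conjugateReal (hf : IsInteriorFee f η) (hs : SplitsInto F f)
    (ψ : EuclideanSpace ℝ (Fin N)) : gradient (conjugateReal F) ψ = optWeight f ψ := by
  refine HasGradientAt.gradient ?_
  rw [hasGradientAt_iff_hasFDerivAt]
  exact hf.hasFDerivAt_conjugateReal hs ψ

lemma hasFDerivAt_fderiv_conjugateReal (hf : IsInteriorFee f η) (hs : SplitsInto F f)
    (ψ : EuclideanSpace ℝ (Fin N)) :
    HasFDerivAt (fderiv ℝ (conjugateReal F))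
      ((innerSL ℝ : _ →L[ℝ] _ →L[ℝ] ℝ).comp
        (Matrix.toEuclideanCLM (n := Fin N) (𝕜 := ℝ) (condensedInv (optCurv f ψ)))) ψ := by
  rw [hf.fderiv_conjugateReal hs]
  exact (innerSL ℝ : EuclideanSpace ℝ (Fin N) →L[ℝ] _ →L[ℝ] ℝ).hasFDerivAt.comp ψ
    (hf.hasFDerivAt_optWeight ψ)

lemma contDiff_conjugateReal (hf : IsInteriorFee f η) (hs : SplitsInto F f) :
    ContDiff ℝ 2 (conjugateReal F) := by
  refine (contDiff_succ_iff_hasFDerivAt (n := 1)).2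
    ⟨fderiv ℝ (conjugateReal F), ?_, fun ψ =>
      (hf.hasFDerivAt_conjugateReal hs ψ).differentiableAt.hasFDerivAt⟩
  exact contDiff_one_iff_hasFDerivAt.2 ⟨_,
    ((ContinuousLinearMap.compL ℝ _ _ _ (innerSL ℝ : _ →L[ℝ] _ →L[ℝ] ℝ)).continuous.comp
      hf.continuous_toEuclideanCLM_condensedInv), hf.hasFDerivAt_fderiv_conjugateReal hs⟩

lemma hessian_conjugateReal (hf : IsInteriorFee f η) (hs : SplitsInto F f)
    (ψ : EuclideanSpace ℝ (Fin N)) :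
    hessian (conjugateReal F) ψ = condensedInv (optCurv f ψ) := by
  -- Entry (i, j) of the Hessian is ⟨M e_i, e_j⟩ = M j i, so symmetry of M is needed.
  rw [← condensedInv_transpose]
  ext i j
  rw [hessian, Matrix.of_apply, (hf.hasFDerivAt_fderiv_conjugateReal hs ψ).fderiv]
  rw [ContinuousLinearMap.comp_apply, innerSL_apply_apply, EuclideanSpace.inner_single_right,
    Matrix.ofLp_toEuclideanCLM]
  simp

lemma bordered_isUnit_and_inv (hf : IsInteriorFee f η) (ψ : EuclideanSpace ℝ (Fin N)) :
    IsUnit (borderedJacobian f (optWeight f ψ)) ∧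
      ((borderedJacobian f (optWeight f ψ))⁻¹).toBlocks₁₁ = condensedInv (optCurv f ψ) := by
  have h := bordered_mul_eq_one (fun i => (hf.optCurv_pos ψ i).ne') (hf.sum_inv_optCurv_pos ψ).ne'
  change borderedJacobian f (optWeight f ψ) * _ = 1 at h
  refine ⟨IsUnit.of_mul_eq_one _ h, ?_⟩
  rw [Matrix.inv_eq_right_inv h, Matrix.toBlocks_fromBlocks₁₁]

end IsInteriorFee

/-! ### Oscillation of ψ on K⁰ -/

section MassSet

variable {n N : ℕ} {X : Set (EuclideanSpace ℝ (Fin n))}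
  {μ : MeasureTheory.Measure (EuclideanSpace ℝ (Fin n))}
  {c : EuclideanSpace ℝ (Fin n) → EuclideanSpace ℝ (Fin n) → ℝ}
  {y : Fin N → EuclideanSpace ℝ (Fin n)}

lemma abs_cost_le_costSup (hX : IsCompact X) (hc : ∀ i, ContinuousOn (fun x => c x (y i)) X)
    {x : EuclideanSpace ℝ (Fin n)} (hx : x ∈ X) (i : Fin N) : |c x (y i)| ≤ costSup X c y := by
  refine le_ciSup (f := fun p : X × Fin N => |c p.1 (y p.2)|) ?_ (⟨x, hx⟩, i)
  choose K hK using fun i => hX.exists_bound_of_continuousOn (hc i)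
  obtain ⟨L, hL⟩ := (Set.finite_range K).bddAbove
  refine ⟨L, ?_⟩
  rintro _ ⟨p, rfl⟩
  exact (hK p.2 p.1 p.1.2).trans (hL (mem_range_self _))

/-- Positive mass makes the i-th cell nonempty; the cell inequality at one of its points bounds ψ^i
- ψ^k by a difference of two costs. -/
lemma sub_le_of_mem_massSet (hX : IsCompact X) (hc : ∀ i, ContinuousOn (fun x => c x (y i)) X)
    {ψ : EuclideanSpace ℝ (Fin N)} (hψ : ψ ∈ massSet X μ c y 0) (i k : Fin N) :
    ψ i - ψ k ≤ 2 * costSup X c y := by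
  have hne : (laguerreCell X c y ψ i).Nonempty := by
    by_contra h
    have := hψ i
    rw [not_nonempty_iff_eq_empty.1 h, MeasureTheory.measureReal_empty] at this
    exact lt_irrefl _ this
  obtain ⟨x, hx, hxk⟩ := hne
  have h1 := abs_le.1 (abs_cost_le_costSup hX hc hx i)
  have h2 := abs_le.1 (abs_cost_le_costSup hX hc hx k)
  linarith [hxk k]

end MassSet

/-! ### Optimal weights stay in S_i; Lipschitz estimates for the Hessian -/

section SlopeBound

variable {N : ℕ} {f : Fin N → ℝ → EReal} {η : ℝ}

lemma neg_d1_add_le_slopeBound (M : ℝ) (k : Fin N)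
    (hk : leftEnd (f k) + marginA f ∈ intDom (f k)) :
    -d1 (f k) (leftEnd (f k) + marginA f) + 2 * M ≤ slopeBound f M := by
  classical
  have h := le_ciSup (f := fun k => if leftEnd (f k) + marginA f ∈ intDom (f k)
      then -d1 (f k) (leftEnd (f k) + marginA f) else 0) (Set.finite_range _).bddAbove k
  simp only [if_pos hk] at h
  refine add_le_add_left ?_ _
  refine le_max_of_le_right (le_max_of_le_left ?_)
  convert h

lemma d1_add_le_slopeBound (M : ℝ) (k : Fin N)
    (hk : rightEnd (f k) - marginB f ∈ intDom (f k)) :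
    d1 (f k) (rightEnd (f k) - marginB f) + 2 * M ≤ slopeBound f M := by
  classical
  have h := le_ciSup (f := fun k => if rightEnd (f k) - marginB f ∈ intDom (f k)
      then d1 (f k) (rightEnd (f k) - marginB f) else 0) (Set.finite_range _).bddAbove k
  simp only [if_pos hk] at h
  refine add_le_add_left ?_ _
  refine le_max_of_le_right (le_max_of_le_right ?_)
  convert h

lemma sum_leftEnd_add_marginA [Nonempty (Fin N)] (f : Fin N → ℝ → EReal) :
    ∑ i, (leftEnd (f i) + marginA f) = 1 := by
  have : (N : ℝ) ≠ 0 := by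
    have := Fin.pos_iff_nonempty.2 ‹Nonempty (Fin N)›
    positivity
  rw [Finset.sum_add_distrib]
  simp [marginA]
  field_simp
  ring

lemma sum_rightEnd_sub_marginB [Nonempty (Fin N)] (f : Fin N → ℝ → EReal) :
    ∑ i, (rightEnd (f i) - marginB f) = 1 := by
  have : (N : ℝ) ≠ 0 := by
    have := Fin.pos_iff_nonempty.2 ‹Nonempty (Fin N)›
    positivity
  rw [Finset.sum_sub_distrib]
  simp [marginB]
  field_simp
  ring

namespace IsInteriorFee

lemma sum_leftEnd_lt_one (hf : IsInteriorFee f η) : ∑ i, leftEnd (f i) < 1 := by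
  have := hf.nonempty_index
  obtain ⟨w, hw, hw1⟩ := hf.exists_interior
  rw [← hw1]
  refine Finset.sum_lt_sum_of_nonempty Finset.univ_nonempty fun i _ => ?_
  exact ((hf.component i).intDom_eq ▸ hw i : w i ∈ Ioo _ _).1

lemma one_lt_sum_rightEnd (hf : IsInteriorFee f η) : 1 < ∑ i, rightEnd (f i) := by
  have := hf.nonempty_index
  obtain ⟨w, hw, hw1⟩ := hf.exists_interior
  rw [← hw1]
  refine Finset.sum_lt_sum_of_nonempty Finset.univ_nonempty fun i _ => ?_
  exact ((hf.component i).intDom_eq ▸ hw i : w i ∈ Ioo _ _).2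

lemma optWeight_mem_slopeSet (hf : IsInteriorFee f η) {M : ℝ} {ψ : EuclideanSpace ℝ (Fin N)}
    (hψ : ∀ i k, ψ i - ψ k ≤ 2 * M) (i : Fin N) : optWeight f ψ i ∈ slopeSet f M i := by
  have hne := hf.nonempty_index
  have hN : (0 : ℝ) < N := Nat.cast_pos.2 (Fin.pos_iff_nonempty.2 hne)
  refine ⟨hf.optWeight_mem ψ i, abs_le.2 ⟨?_, ?_⟩⟩
  -- Pigeonhole: w and (a_k + A) both sum to 1, so w^k ≥ a_k + A for some k. This bounds ψ^k - r
  -- below, and passing to ψ^i - r costs at most 2M.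
  · obtain ⟨k, -, hk⟩ := Finset.exists_le_of_sum_le Finset.univ_nonempty
      ((sum_leftEnd_add_marginA f).trans (hf.optWeight_sum ψ).symm).le
    have hA : 0 < marginA f := div_pos (sub_pos.2 hf.sum_leftEnd_lt_one) hN
    have hw : optWeight f ψ k ∈ Ioo _ _ := (hf.component k).intDom_eq ▸ hf.optWeight_mem ψ k
    -- The point lies strictly above a_k as A > 0, and strictly below b_k as it is at most w^k;
    -- hence k does enter the maximum defining C₁.
    have hmem : leftEnd (f k) + marginA f ∈ intDom (f k) := by
      rw [(hf.component k).intDom_eq]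
      exact ⟨by linarith, hk.trans_lt hw.2⟩
    have h1 := (hf.component k).d1_strictMonoOn.monotoneOn hmem (hf.optWeight_mem ψ k) hk
    have h2 := neg_d1_add_le_slopeBound M k hmem
    rw [hf.d1_optWeight] at h1 ⊢
    linarith [hψ k i]
  · obtain ⟨k, -, hk⟩ := Finset.exists_le_of_sum_le Finset.univ_nonempty
      ((hf.optWeight_sum ψ).trans (sum_rightEnd_sub_marginB f).symm).le
    have hB : 0 < marginB f := div_pos (sub_pos.2 hf.one_lt_sum_rightEnd) hN
    have hw : optWeight f ψ k ∈ Ioo _ _ := (hf.component k).intDom_eq ▸ hf.optWeight_mem ψ k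
    have hmem : rightEnd (f k) - marginB f ∈ intDom (f k) := by
      rw [(hf.component k).intDom_eq]
      exact ⟨hw.1.trans_le hk, by linarith⟩
    have h1 := (hf.component k).d1_strictMonoOn.monotoneOn (hf.optWeight_mem ψ k) hmem hk
    have h2 := d1_add_le_slopeBound M k hmem
    rw [hf.d1_optWeight] at h1 ⊢
    linarith [hψ i k]

lemma abs_condensedInv_optCurv_sub_le (hf : IsInteriorFee f η) {M : ℝ}
    {φ ψ : EuclideanSpace ℝ (Fin N)} (hφ : ∀ i k, φ i - φ k ≤ 2 * M)
    (hψ : ∀ i k, ψ i - ψ k ≤ 2 * M) (i j : Fin N) :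
    |(condensedInv (optCurv f φ) - condensedInv (optCurv f ψ)) i j| ≤
      N * lipConst f M * η⁻¹ ^ 3 * ‖φ - ψ‖ := by
  have h := abs_condensedInv_sub_apply_le (d := optCurv f φ) (e := optCurv f ψ)
    (δ := lipConst f M * (η⁻¹ * ‖φ - ψ‖)) hf.eta_pos
    (fun k => (hf.component k).eta_le_d2 _ (hf.optWeight_mem φ k))
    (fun k => (hf.component k).eta_le_d2 _ (hf.optWeight_mem ψ k)) (fun k => ?_) i j
  · exact h.trans (le_of_eq (by ring))
  · refine (abs_d2_sub_le hf.component (hf.optWeight_mem_slopeSet hφ k)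
      (hf.optWeight_mem_slopeSet hψ k)).trans ?_
    refine mul_le_mul_of_nonneg_left ?_ (lipConst_nonneg f M)
    exact (PiLp.norm_apply_le (optWeight f φ - optWeight f ψ) k).trans
      (hf.norm_optWeight_sub_le φ ψ)

variable {F : EuclideanSpace ℝ (Fin N) → EReal}

lemma frobNorm_hessian_sub_le (hf : IsInteriorFee f η) (hs : SplitsInto F f) {M : ℝ}
    {φ ψ : EuclideanSpace ℝ (Fin N)} (hφ : ∀ i k, φ i - φ k ≤ 2 * M)
    (hψ : ∀ i k, ψ i - ψ k ≤ 2 * M) :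
    frobNorm (hessian (conjugateReal F) φ - hessian (conjugateReal F) ψ) ≤
      4 * (N : ℝ) ^ 2 * lipConst f M * η⁻¹ ^ 3 * ‖φ - ψ‖ := by
  rw [hf.hessian_conjugateReal hs, hf.hessian_conjugateReal hs]
  have hL := lipConst_nonneg f M
  have hη := inv_nonneg.2 hf.eta_pos.le
  refine (frobNorm_le (by positivity) (hf.abs_condensedInv_optCurv_sub_le hφ hψ)).trans ?_
  -- The argument gives the estimate with factor 1; the factor 4 is slack.
  have : 0 ≤ (N : ℝ) ^ 2 * lipConst f M * η⁻¹ ^ 3 * ‖φ - ψ‖ := by positivity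
  linarith

lemma isC21On_conjugateReal (hf : IsInteriorFee f η) (hs : SplitsInto F f) {M : ℝ}
    {U : Set (EuclideanSpace ℝ (Fin N))} (hU : ∀ ψ ∈ U, ∀ i k, ψ i - ψ k ≤ 2 * M) :
    IsC21On (conjugateReal F) U := by
  refine ⟨fun ψ _ => (hf.contDiff_conjugateReal hs).contDiffAt, ?_⟩
  obtain ⟨K, hK, hKle⟩ := exists_norm_toEuclideanCLM_le N
  have hL := lipConst_nonneg f M
  have hη := inv_nonneg.2 hf.eta_pos.le
  set S := ‖(innerSL ℝ : EuclideanSpace ℝ (Fin N) →L[ℝ] _ →L[ℝ] ℝ)‖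
  have hC : 0 ≤ S * (K * (N * lipConst f M * η⁻¹ ^ 3)) := by positivity
  refine ⟨⟨_, hC⟩, LipschitzOnWith.of_dist_le_mul fun φ hφ ψ hψ => ?_⟩
  rw [dist_eq_norm, dist_eq_norm, (hf.hasFDerivAt_fderiv_conjugateReal hs φ).fderiv,
    (hf.hasFDerivAt_fderiv_conjugateReal hs ψ).fderiv, ← ContinuousLinearMap.comp_sub, ← map_sub]
  refine (ContinuousLinearMap.opNorm_comp_le _ _).trans ?_
  refine (mul_le_mul_of_nonneg_left (hKle _ _
    (hf.abs_condensedInv_optCurv_sub_le (hU φ hφ) (hU ψ hψ))) (norm_nonneg _)).trans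
    (le_of_eq ?_)
  change S * _ = S * _ * _
  ring

end IsInteriorFee

end SlopeBound

/-! ### Single-point domain: smoothness and vanishing Hessian -/

section Degenerate

variable {N : ℕ} {F : EuclideanSpace ℝ (Fin N) → EReal} {w : EuclideanSpace ℝ (Fin N)}

lemma contDiff_conjugateReal_of_effDom_eq_singleton (hF : IsProper F) (hw : effDom F = {w}) :
    ContDiff ℝ 2 (conjugateReal F) := by
  rw [conjugateReal_of_effDom_eq_singleton hF hw]
  exact (innerSL ℝ w).contDiff.sub contDiff_const

lemma hessian_of_effDom_eq_singleton (hF : IsProper F) (hw : effDom F = {w})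
    (ψ : EuclideanSpace ℝ (Fin N)) : hessian (conjugateReal F) ψ = 0 := by
  ext i j
  rw [hessian, Matrix.of_apply, fderiv_fderiv_conjugateReal_of_effDom_eq_singleton hF hw]
  rfl

end Degenerate

end SemiDiscrete

/-! ### The theorem, split by whether dom F is a single point -/

theorem mainTheorem5 {n N : ℕ}
    -- the source: a compact set `X` and a probability measure `μ` on it
    (X : Set (EuclideanSpace ℝ (Fin n))) (hX : IsCompact X)
    (μ : MeasureTheory.Measure (EuclideanSpace ℝ (Fin n)))
    [MeasureTheory.IsProbabilityMeasure μ] (hμ : μ Xᶜ = 0)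
    -- the target points and the cost
    (y : Fin N → EuclideanSpace ℝ (Fin n))
    (c : EuclideanSpace ℝ (Fin n) → EuclideanSpace ℝ (Fin n) → ℝ)
    (hc : ∀ i, ContinuousOn (fun x => c x (y i)) X)
    -- the storage fee function
    (F : EuclideanSpace ℝ (Fin N) → EReal) (hF : IsStorageFee F)
    (f : Fin N → ℝ → EReal) (hsplit : SplitsInto F f)
    (hsmooth : ∀ i, IsEssentiallySmooth (f i))
    (htwice : ∀ i, DifferentiableOn ℝ (d1 (f i)) (intDom (f i)))
    (hlip : ∀ i, LocallyLipschitzOn (intDom (f i)) (d2 (f i)))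
    (η : ℝ) (hη : 0 < η) (hstrong : ∀ i, ∀ x ∈ intDom (f i), η ≤ d2 (f i) x) :
    -- `F*` is finite everywhere
    (∀ ψ, ((conjugateReal F ψ : ℝ) : EReal) = conjugate F ψ) ∧
    -- `F*` is `C²` on the whole space and `C^{2,1}` on `K⁰`
    ContDiff ℝ 2 (conjugateReal F) ∧
    IsC21On (conjugateReal F) (massSet X μ c y 0) ∧
    -- the formula for the Hessian, unless the domain of `F` is a single point
    ((effDom F).Nontrivial → ∀ ψ,
      (∀ i, gradient (conjugateReal F) ψ i ∈ intDom (f i)) ∧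
      IsUnit (borderedJacobian f (gradient (conjugateReal F) ψ)) ∧
      hessian (conjugateReal F) ψ =
        ((borderedJacobian f (gradient (conjugateReal F) ψ))⁻¹).toBlocks₁₁) ∧
    -- the sets `S_i` are compact in the interior of the domains, and `C_f` is finite
    (∀ i, IsCompact (slopeSet f (costSup X c y) i) ∧
      slopeSet f (costSup X c y) i ⊆ intDom (f i) ∧
      BddAbove (quotientSet f (costSup X c y) i)) ∧
    -- the Lipschitz estimate
    ∀ ψ₁ ∈ massSet X μ c y 0, ∀ ψ₂ ∈ massSet X μ c y 0,
      frobNorm (hessian (conjugateReal F) ψ₁ - hessian (conjugateReal F) ψ₂) ≤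
        4 * (N : ℝ) ^ 2 * lipConst f (costSup X c y) * η⁻¹ ^ 3 * ‖ψ₁ - ψ₂‖ := by
  have hf : ∀ i, IsFeeComponent (f i) η := fun i =>
    ⟨(hsplit.1 i).1, (hsplit.1 i).2, hsmooth i, htwice i, hlip i, hη, hstrong i⟩
  have hslope : ∀ i, IsCompact (slopeSet f (costSup X c y) i) ∧
      slopeSet f (costSup X c y) i ⊆ intDom (f i) ∧
      BddAbove (quotientSet f (costSup X c y) i) := fun i =>
    ⟨isCompact_slopeSet hf _ i, fun _ hx => hx.1, bddAbove_quotientSet hf _ i⟩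
  by_cases hnt : (effDom F).Nontrivial
  · obtain ⟨ha, hb⟩ := hsplit.sum_leftEnd_lt_one_lt_sum_rightEnd hf hnt
    have hI := isInteriorFee_of_sum_lt hf ha hb
    have hU : ∀ ψ ∈ massSet X μ c y 0, ∀ i k, ψ i - ψ k ≤ 2 * costSup X c y :=
      fun ψ hψ => sub_le_of_mem_massSet hX hc hψ
    refine ⟨hI.coe_conjugateReal hsplit, hI.contDiff_conjugateReal hsplit,
      hI.isC21On_conjugateReal hsplit hU, fun _ ψ => ?_, hslope, fun ψ₁ h₁ ψ₂ h₂ =>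
      hI.frobNorm_hessian_sub_le hsplit (hU ψ₁ h₁) (hU ψ₂ h₂)⟩
    rw [hI.gradient_conjugateReal hsplit, hI.hessian_conjugateReal hsplit]
    obtain ⟨h1, h2⟩ := hI.bordered_isUnit_and_inv ψ
    exact ⟨hI.optWeight_mem ψ, h1, h2.symm⟩
  · have hp := hF.1.proper
    obtain ⟨w, hw⟩ : ∃ w, effDom F = {w} := by
      obtain ⟨w, hw⟩ := hp.2
      exact ⟨w, (Set.not_nontrivial_iff.1 hnt).eq_singleton_of_mem hw⟩
    have hC := contDiff_conjugateReal_of_effDom_eq_singleton hp hw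
    refine ⟨fun ψ => ?_, hC, ⟨fun ψ _ => hC.contDiffAt, 0, ?_⟩, fun h => absurd h hnt, hslope,
      fun ψ₁ _ ψ₂ _ => ?_⟩
    · rw [conjugateReal, conjugate_of_effDom_eq_singleton hp hw, EReal.toReal_coe]
    · rw [fderiv_fderiv_conjugateReal_of_effDom_eq_singleton hp hw]
      exact (LipschitzWith.const 0).lipschitzOnWith
    · rw [hessian_of_effDom_eq_singleton hp hw, hessian_of_effDom_eq_singleton hp hw]
      have := lipConst_nonneg f (costSup X c y)
      have h0 : frobNorm ((0 : Matrix (Fin N) (Fin N) ℝ) - 0) = 0 := by simp [frobNorm]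
      rw [h0]
      positivity
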